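/- A binary classification problem on a measurable space $X$ consists of a probability measure $\mu$ on $X$ and a measurable function $p=(p_0,p_1)\colon X\to\Delta^2$, where $\Delta^2=\{(t_0,t_1)\in[0,1]^2: t_0+t_1=1\}$ and $p_y(x)$ is the probability that $x$ has label $y\in\{0,1\}$; the distribution of $p$ under $\mu$ is assumed to be absolutely continuous with respect to Lebesgue measure on the segment $\Delta^2$. A decision is a measurable function $d=(d_0,d_1)\colon X\to\Delta^2$; the prediction $\widehat Y$ at $x$ equals $j$ with probability $d_j(x)$, independently of the true label $Y$, so that $P(\widehat Y=j,Y=i)=\int_X d_j\,p_i\,d\mu$. Put $\mathrm{TN}(d)=P(\widehat Y=0,Y=0)$, $\mathrm{TP}(d)=P(\widehat Y=1,Y=1)$ and $\mathrm{IPS}(X)=\{(\mathrm{TN}(d),\mathrm{TP}(d)) : d \text{ a decision}\}$. A decision is deterministic if almost everywhere $d_0=1$ or $d_1=1$. An evaluation metric is a real-valued function $L(d,X)$ of a binary classification problem (written $X$) and a decision $d$ on it such that (i) $L(d,X)\le L(d',X)$ whenever $\mathrm{TN}(d)\le \mathrm{TN}(d')$ and $\mathrm{TP}(d)\le \mathrm{TP}(d')$,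 and (ii) $L(d\circ p,X)=L(d,\Delta_X)$ for every decision $d$ on $\Delta^2$, where $\Delta_X$ is the problem on $\Delta^2$ whose measure is the distribution of $p$ and whose label probabilities at $t$ are $t$. It is continuous if it depends continuously on $(\mathrm{TN}(d),\mathrm{TP}(d),\mathrm{IPS}(X))$, the distance of two sets $\mathrm{IPS}(X),\mathrm{IPS}(X')$ being the Lebesgue measure of their symmetric difference. Given a finite family of measurable subsets of $X$ (groups), a decision $d$ does not cherry-pick within these groups if for each group $A$ and almost all $x,x'\in A$: if $p_1(x)\le p_1(x')$ then $P(\widehat Y(x')=0\mid \widehat Y(x)=1)=0$; the predictions at $x$ and $x'$ being independent, this means that $d_1(x)>0$ implies $d_0(x')=0$. **Theorem.** Let a binary classification problem on $X$ be given, let $\{A_0,A_1\}$ be a partition of $X$ into two measurable sensitive groups of positive measure, and let $F(d)$ be one of - the Demographic Parity Difference $|P(\widehat Y=1\mid A_1)-P(\widehat Y=1\mid A_0)|$, - the Equal Opportunity Difference $|P(\widehat Y=1\mid Y=1,A_1)-P(\widehat Y=1\mid Y=1,A_0)|$, - the Equal Risk Difference $|P(\widehat Y=0\mid Y=0,A_1)-P(\widehat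 Y=0\mid Y=0,A_0)|$. Let $L$ be an evaluation metric. If $L$ is continuous, or, for arbitrary $L$, if the problem $$\operatorname*{arg\,max}_{d\colon X\to\Delta^2}\; L(d,X)-F(d)$$ has a solution at all, then it has a solution that is deterministic and does not cherry-pick within the groups $A_0$, $A_1$. The same holds for the conditional versions of the three measures: if $S\subseteq X$ is a measurable set (the individuals who satisfy a given requirement) such that $A_0\cap S$ and $A_1\cap S$ have positive measure, and $A_0,A_1$ are replaced by $A_0\cap S,A_1\cap S$ in the definition of $F$, then, under the same assumption on $L$ and the new problem, there is a deterministic solution (among all decisions on $X$) that does not cherry-pick within the groups $A_0\cap S$, $A_1\cap S$, $A_0\setminus S$, $A_1\setminus S$. -/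

import Mathlib

open MeasureTheory Set
open scoped symmDiff

universe u

noncomputable section

/-- The simplex `Δ²` of probability vectors `(t₀, t₁)` on the two labels `0, 1`. -/
abbrev Simplex2 : Type := stdSimplex ℝ (Fin 2)

/-- Lebesgue measure on the segment `Δ²` (transported from `[0,1]` along the affine
parametrisation of the segment). -/
def simplexVolume : Measure Simplex2 :=
  (volume : Measure unitInterval).map stdSimplexHomeomorphUnitInterval.symm

/-- A binary classification problem on the feature space `X`: a probability measure `μ` on `X` and
the conditional label probabilities `p x = (p(y = 0 | x), p(y = 1 | x))`, whose distribution on the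
simplex is absolutely continuous with respect to Lebesgue measure. -/
structure ClassificationProblem (X : Type u) [MeasurableSpace X] where
  μ : Measure X
  isProbabilityMeasure : IsProbabilityMeasure μ
  p : X → Simplex2
  measurable_p : Measurable p
  absolutelyContinuous : μ.map p ≪ simplexVolume

/-- A decision (probabilistic classifier): `d x = (d₀(x), d₁(x))` is the distribution of the
predicted label `Ŷ` at `x`. -/
structure Decision (X : Type u) [MeasurableSpace X] where
  toFun : X → Simplex2
  measurable_toFun : Measurable toFun

instance (X : Type u) [MeasurableSpace X] : CoeFun (Decision X) (fun _ => X → Simplex2) :=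
  ⟨Decision.toFun⟩

namespace ClassificationProblem

variable {X : Type u} [MeasurableSpace X]

/-- The confusion matrix: the entry `(i, j)` is `P(Ŷ = j, Y = i) = ∫ dⱼ(x) p(y = i | x) μ(dx)`. -/
def confusion (P : ClassificationProblem X) (d : Decision X) : Matrix (Fin 2) (Fin 2) ℝ :=
  Matrix.of fun i j => ∫ x, (d x).1 j * (P.p x).1 i ∂P.μ

/-- Probability of a true negative, `P(Ŷ = 0, Y = 0)`. -/
def trueNeg (P : ClassificationProblem X) (d : Decision X) : ℝ := P.confusion d 0 0

/-- Probability of a true positive, `P(Ŷ = 1, Y = 1)`. -/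
def truePos (P : ClassificationProblem X) (d : Decision X) : ℝ := P.confusion d 1 1

/-- The Pareto pre-order `d ≾ d'` on decisions. -/
def ParetoLE (P : ClassificationProblem X) (d d' : Decision X) : Prop :=
  ∀ i, P.confusion d i i ≤ P.confusion d' i i

/-- The individual pieces set: all diagonals of confusion matrices of decisions. -/
def IPS (P : ClassificationProblem X) : Set (ℝ × ℝ) :=
  range fun d : Decision X => (P.trueNeg d, P.truePos d)

/-- The decision `d ∘ p` on `X` induced by a decision `d` on the simplex (lifted to the universe
of `X`). -/
def pullback (P : ClassificationProblem X) (d : Decision (ULift.{u} Simplex2)) : Decision X where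
  toFun x := d (ULift.up (P.p x))
  measurable_toFun := d.measurable_toFun.comp (measurable_up.comp P.measurable_p)

/-- The classification problem `Δ_X` on the simplex (lifted to the universe of `X`): the measure is
the distribution of `p`, and the conditional label probabilities at `t` are `t`. -/
def onSimplex (P : ClassificationProblem X) : ClassificationProblem (ULift.{u} Simplex2) where
  μ := P.μ.map (ULift.up ∘ P.p)
  isProbabilityMeasure := by
    have := P.isProbabilityMeasure
    exact Measure.isProbabilityMeasure_map (measurable_up.comp P.measurable_p).aemeasurable
  p := ULift.down
  measurable_p := measurable_down
  absolutelyContinuous := by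
    rw [Measure.map_map measurable_down (measurable_up.comp P.measurable_p)]
    exact P.absolutelyContinuous

/-- The probability of an event `E` about `(x, Y, Ŷ)`, where `x ∼ μ` and, given `x`, the label
`Y ∼ p x` and the prediction `Ŷ ∼ d x` are independent. -/
def prob (P : ClassificationProblem X) (d : Decision X) (E : Set (X × Fin 2 × Fin 2)) : ℝ :=
  ∑ i, ∑ j, ∫ x in {x | (x, i, j) ∈ E}, (d x).1 j * (P.p x).1 i ∂P.μ

/-- The conditional probability `P(E | C)`. -/
def condProb (P : ClassificationProblem X) (d : Decision X) (E C : Set (X × Fin 2 × Fin 2)) : ℝ :=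
  P.prob d (E ∩ C) / P.prob d C

/-- The decision is almost everywhere equal to a single label. -/
def IsDeterministic (P : ClassificationProblem X) (d : Decision X) : Prop :=
  ∀ᵐ x ∂P.μ, ∃ i, (d x).1 i = 1

/-- The decision does not cherry-pick within any of the given groups: for every group `A` and
almost all `x, x' ∈ A`, if `p(y = 1 | x) ≤ p(y = 1 | x')` then `P(Ŷ(x') = 0 | Ŷ(x) = 1) = 0`.
The predictions `Ŷ(x) ∼ d x` and `Ŷ(x') ∼ d x'` are independent, so this conditional probability is
`d₀(x')` as soon as the event `Ŷ(x) = 1` has positive probability `d₁(x)`; otherwise there is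
nothing to require. -/
def NoCherryPick (P : ClassificationProblem X) (groups : Set (Set X)) (d : Decision X) : Prop :=
  ∀ A ∈ groups, ∀ᵐ z ∂(P.μ.restrict A).prod (P.μ.restrict A),
    (P.p z.1).1 1 ≤ (P.p z.2).1 1 → 0 < (d z.1).1 1 → (d z.2).1 0 = 0

end ClassificationProblem

/-- The three group fairness measures. -/
inductive FairnessMeasure
  | demographicParity
  | equalOpportunity
  | equalRisk

/-- The value of the fairness measure on the decision `d` for the (disjoint) groups `A₀`, `A₁`.
Events are sets of triples `(x, y, ŷ)`:
* demographic parity difference `|P(Ŷ=1 | A₁) - P(Ŷ=1 | A₀)|`;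
* equal opportunity difference `|P(Ŷ=1 | Y=1, A₁) - P(Ŷ=1 | Y=1, A₀)|`;
* equal risk difference `|P(Ŷ=0 | Y=0, A₁) - P(Ŷ=0 | Y=0, A₀)|`. -/
def FairnessMeasure.value {X : Type u} [MeasurableSpace X] (F : FairnessMeasure)
    (P : ClassificationProblem X) (A₀ A₁ : Set X) (d : Decision X) : ℝ :=
  match F with
  | demographicParity =>
      |P.condProb d {z | z.2.2 = 1} {z | z.1 ∈ A₁} - P.condProb d {z | z.2.2 = 1} {z | z.1 ∈ A₀}|
  | equalOpportunity =>
      |P.condProb d {z | z.2.2 = 1} {z | z.2.1 = 1 ∧ z.1 ∈ A₁}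
        - P.condProb d {z | z.2.2 = 1} {z | z.2.1 = 1 ∧ z.1 ∈ A₀}|
  | equalRisk =>
      |P.condProb d {z | z.2.2 = 0} {z | z.2.1 = 0 ∧ z.1 ∈ A₁}
        - P.condProb d {z | z.2.2 = 0} {z | z.2.1 = 0 ∧ z.1 ∈ A₀}|

/-- Real-valued functions `L(d, X)` of a decision and of the classification problem. -/
abbrev Evaluation : Type (u + 1) :=
  ∀ (X : Type u) [MeasurableSpace X], ClassificationProblem X → Decision X → ℝ

/-- Evaluation metrics: monotone for the Pareto pre-order, and compatible with passing to the
simplex. -/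
structure IsEvaluationMetric (L : Evaluation.{u}) : Prop where
  mono : ∀ (X : Type u) [MeasurableSpace X] (P : ClassificationProblem X) (d d' : Decision X),
    P.ParetoLE d d' → L X P d ≤ L X P d'
  simplex : ∀ (X : Type u) [MeasurableSpace X] (P : ClassificationProblem X)
    (d : Decision (ULift.{u} Simplex2)),
    L X P (P.pullback d) = L (ULift.{u} Simplex2) P.onSimplex d

/-- Continuity of an evaluation: `L(d, X)` depends continuously on the probabilities of a true
negative and of a true positive and on the individual pieces set of the problem, where the distance
of two individual pieces sets is the Lebesgue measure of their symmetric difference. -/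
def Evaluation.IsContinuous (L : Evaluation.{u}) : Prop :=
  ∀ (X : Type u) [MeasurableSpace X] (P : ClassificationProblem X) (d : Decision X),
    ∀ ε : ℝ, 0 < ε → ∃ δ : ℝ, 0 < δ ∧
      ∀ (X' : Type u) [MeasurableSpace X'] (P' : ClassificationProblem X') (d' : Decision X'),
        |P'.trueNeg d' - P.trueNeg d| < δ → |P'.truePos d' - P.truePos d| < δ →
        volume (P'.IPS ∆ P.IPS) < ENNReal.ofReal δ →
        |L X' P' d' - L X P d| < ε

/-- `d` solves `argmax_d L(d, X) - F(d)`, where `F` is the fairness measure for the groups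
`A₀`, `A₁`. -/
def IsFairOptimum {X : Type u} [MeasurableSpace X] (P : ClassificationProblem X)
    (L : Evaluation.{u}) (F : FairnessMeasure) (A₀ A₁ : Set X) (d : Decision X) : Prop :=
  ∀ d' : Decision X, L X P d' - F.value P A₀ A₁ d' ≤ L X P d - F.value P A₀ A₁ d

end

/-! On a group, `F` depends on a decision only through the mass of its positive predictions weighted
by `1`, `p₁` or `1 - p₁` (`exists_continuous_value_eq`). Split `X` into finitely many cells, each
group being one cell. As `p₁` has no atoms, the weighted mass of a threshold rule varies
continuously with its threshold, so each decision `d` is matched on every cell by a threshold rule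
`t` of equal weighted mass (`exists_threshold_eq`). The matching leaves `F` unchanged, and `(t -
d)(p₁ - c) ≥ 0` shows that it loses neither true positives nor true negatives
(`pareto_of_threshold`). By monotonicity of `L` the objective does not decrease.

Hence a given optimum can be replaced by a threshold rule; for continuous `L` the objective is
continuous on the compact cube of thresholds and attains its maximum there. Threshold rules are
deterministic and do not cherry-pick within a cell. -/

noncomputable section

/-! ### Decisions and problems in terms of their second coordinate -/

namespace Decision

variable {X : Type u} [MeasurableSpace X]

/-- The probability `d₁(x)` of predicting the label `1`. -/
def pos (d : Decision X) (x : X) : ℝ := (d x).1 1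

lemma coord_zero (d : Decision X) (x : X) : (d x).1 0 = 1 - d.pos x := by
  have h := (d x).2.2
  rw [Fin.sum_univ_two] at h
  simp only [pos]
  linarith

lemma pos_nonneg (d : Decision X) (x : X) : 0 ≤ d.pos x := (d x).2.1 1

lemma pos_le_one (d : Decision X) (x : X) : d.pos x ≤ 1 := by
  have h := (d x).2.1 0
  rw [coord_zero] at h
  linarith

@[fun_prop]
lemma measurable_pos (d : Decision X) : Measurable d.pos :=
  (measurable_pi_apply 1).comp (measurable_subtype_coe.comp d.measurable_toFun)

open Classical in
/-- The deterministic decision that predicts `1` exactly on `s`. -/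
def ofSet (s : Set X) (hs : MeasurableSet s) : Decision X where
  toFun x := if x ∈ s then ⟨_, single_mem_stdSimplex ℝ 1⟩ else ⟨_, single_mem_stdSimplex ℝ 0⟩
  measurable_toFun := Measurable.ite hs measurable_const measurable_const

lemma pos_ofSet (s : Set X) (hs : MeasurableSet s) : (ofSet s hs).pos = s.indicator 1 := by
  classical
  ext x
  by_cases hx : x ∈ s <;> simp [ofSet, pos, hx]

end Decision

namespace ClassificationProblem

variable {X : Type u} [MeasurableSpace X] (P : ClassificationProblem X)

instance : IsProbabilityMeasure P.μ := P.isProbabilityMeasure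

/-- The probability `p₁(x)` of the label `1`. -/
def pos (x : X) : ℝ := (P.p x).1 1

lemma coord_zero (x : X) : (P.p x).1 0 = 1 - P.pos x := by
  have h := (P.p x).2.2
  rw [Fin.sum_univ_two] at h
  simp only [pos]
  linarith

lemma pos_nonneg (x : X) : 0 ≤ P.pos x := (P.p x).2.1 1

lemma pos_le_one (x : X) : P.pos x ≤ 1 := by
  have h := (P.p x).2.1 0
  rw [coord_zero] at h
  linarith

@[fun_prop]
lemma measurable_pos : Measurable P.pos :=
  (measurable_pi_apply 1).comp (measurable_subtype_coe.comp P.measurable_p)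

lemma truePos_eq (d : Decision X) : P.truePos d = ∫ x, d.pos x * P.pos x ∂P.μ := rfl

lemma trueNeg_eq (d : Decision X) :
    P.trueNeg d = ∫ x, (1 - d.pos x) * (1 - P.pos x) ∂P.μ := by
  simp [trueNeg, confusion, Decision.coord_zero, coord_zero]

/-- A point of the segment is determined by its second coordinate, and Lebesgue measure has no
atoms. This is how absolute continuity enters the proof. -/
lemma ae_pos_ne (a : ℝ) : ∀ᵐ x ∂P.μ, P.pos x ≠ a := by
  have hmeas : MeasurableSet {s : Simplex2 | s.1 1 = a} :=
    measurableSet_eq_fun ((measurable_pi_apply 1).comp measurable_subtype_coe) measurable_const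
  have hsub : {s : Simplex2 | s.1 1 = a}.Subsingleton := by
    intro s hs t ht
    have h1 := s.2.2
    have h2 := t.2.2
    rw [Fin.sum_univ_two] at h1 h2
    simp only [mem_ofPred_eq] at hs ht
    apply Subtype.ext
    ext i
    fin_cases i
    · simp only [Fin.zero_eta]; linarith
    · simp only [Fin.mk_one]; linarith
  have h0 : simplexVolume {s : Simplex2 | s.1 1 = a} = 0 := by
    rw [simplexVolume, Measure.map_apply stdSimplexHomeomorphUnitInterval.symm.measurable hmeas]
    exact (hsub.preimage stdSimplexHomeomorphUnitInterval.symm.injective).measure_zero _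
  have h := P.absolutelyContinuous h0
  rw [Measure.map_apply P.measurable_p hmeas] at h
  simpa [ae_iff, pos] using h

/-- A measurable function with values in `[-1, 1]` is integrable for a finite measure. -/
lemma integrable_of_abs_le_one {ν : Measure X} [IsFiniteMeasure ν] {f : X → ℝ}
    (hf : Measurable f) (h : ∀ x, |f x| ≤ 1) : Integrable f ν :=
  Integrable.of_bound hf.aestronglyMeasurable 1 (.of_forall h)

/-! ### Threshold decisions -/

section Threshold

variable {ι : Type*} [Fintype ι] [MeasurableSpace ι] [MeasurableSingletonClass ι]
  {g : X → ι} (hg : Measurable g)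

include hg in
lemma measurableSet_threshold (c : ι → ℝ) : MeasurableSet {x | c (g x) ≤ P.pos x} :=
  measurableSet_le ((measurable_of_countable c).comp hg) P.measurable_pos

/-- The decision that predicts `1` where `p₁` reaches the threshold of the group. -/
def threshold (c : ι → ℝ) : Decision X :=
  Decision.ofSet {x | c (g x) ≤ P.pos x} (P.measurableSet_threshold hg c)

lemma pos_threshold (c : ι → ℝ) (x : X) :
    (P.threshold hg c).pos x = if c (g x) ≤ P.pos x then 1 else 0 := by
  rw [threshold, Decision.pos_ofSet]
  simp [indicator]

lemma isDeterministic_threshold (c : ι → ℝ) : P.IsDeterministic (P.threshold hg c) := by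
  refine .of_forall fun x => ?_
  have h := P.pos_threshold hg c x
  split_ifs at h
  · exact ⟨1, h⟩
  · exact ⟨0, by rw [Decision.coord_zero, h, sub_zero]⟩

lemma noCherryPick_threshold (c : ι → ℝ) {groups : Set (Set X)}
    (hgroups : ∀ A ∈ groups, MeasurableSet A ∧ ∃ i, ∀ x ∈ A, g x = i) :
    P.NoCherryPick groups (P.threshold hg c) := by
  intro A hA
  obtain ⟨hAm, i, hi⟩ := hgroups A hA
  rw [Measure.prod_restrict]
  filter_upwards [ae_restrict_mem (hAm.prod hAm)] with z hz hle hpos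
  change P.pos z.1 ≤ P.pos z.2 at hle
  change 0 < (P.threshold hg c).pos z.1 at hpos
  rw [pos_threshold, hi _ hz.1] at hpos
  rw [Decision.coord_zero, pos_threshold, hi _ hz.2]
  split_ifs at hpos with h
  · rw [if_pos (h.trans hle), sub_self]
  · exact absurd hpos (lt_irrefl _)

/-- Integrals against a threshold decision depend continuously on the thresholds. -/
lemma continuous_integral_threshold {h : X → ℝ} {s : Set X} (hh : Integrable h P.μ) :
    Continuous fun c : ι → ℝ => ∫ x in s, (P.threshold hg c).pos x * h x ∂P.μ := by
  refine continuous_iff_continuousAt.2 fun c => ?_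
  refine continuousAt_of_dominated (bound := fun x => |h x|) (.of_forall fun c' => ?_)
    (.of_forall fun c' => .of_forall fun x => ?_) hh.abs.integrableOn (ae_restrict_of_ae ?_)
  · exact (Decision.measurable_pos _).aestronglyMeasurable.mul hh.aestronglyMeasurable.restrict
  · rw [Real.norm_eq_abs, abs_mul, abs_of_nonneg (Decision.pos_nonneg _ x)]
    exact mul_le_of_le_one_left (abs_nonneg _) (Decision.pos_le_one _ x)
  -- Off the null set where `p₁` equals one of the finitely many thresholds, the decision at `x` is
  -- locally constant in `c'` near `c`.
  · filter_upwards [ae_all_iff.2 fun i => P.ae_pos_ne (c i)] with x hx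
    have hcont : ContinuousAt (fun c' : ι → ℝ => c' (g x)) c := (continuous_apply _).continuousAt
    refine ContinuousAt.mul ?_ continuousAt_const
    simp only [pos_threshold]
    rcases lt_or_gt_of_ne (hx (g x)) with hlt | hlt
    · refine (continuousAt_const (y := (0 : ℝ))).congr ?_
      filter_upwards [hcont.eventually (lt_mem_nhds hlt)] with c' hc'
      rw [if_neg hc'.not_ge]
    · refine (continuousAt_const (y := (1 : ℝ))).congr ?_
      filter_upwards [hcont.eventually (gt_mem_nhds hlt)] with c' hc'
      rw [if_pos hc'.le]

end Threshold

end ClassificationProblem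

/-! ### Fairness measures through weighted masses -/

/-- The density (a function of `p₁(x)`) against which the positive predictions enter the
fairness measure. -/
def FairnessMeasure.weight : FairnessMeasure → ℝ → ℝ
  | demographicParity, _ => 1
  | equalOpportunity, t => t
  | equalRisk, t => 1 - t

lemma FairnessMeasure.continuous_weight (F : FairnessMeasure) : Continuous F.weight := by
  cases F <;> unfold weight <;> fun_prop

lemma FairnessMeasure.weight_nonneg (F : FairnessMeasure) {t : ℝ} (h0 : 0 ≤ t) (h1 : t ≤ 1) :
    0 ≤ F.weight t := by
  cases F <;> simp [weight, h0, h1]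

lemma FairnessMeasure.weight_le_one (F : FairnessMeasure) {t : ℝ} (h0 : 0 ≤ t) (h1 : t ≤ 1) :
    F.weight t ≤ 1 := by
  cases F <;> simp [weight, h0, h1]

namespace ClassificationProblem

variable {X : Type u} [MeasurableSpace X] (P : ClassificationProblem X)

lemma integrable_weight (F : FairnessMeasure) : Integrable (fun x => F.weight (P.pos x)) P.μ := by
  refine integrable_of_abs_le_one (F.continuous_weight.measurable.comp P.measurable_pos) fun x => ?_
  rw [abs_of_nonneg (F.weight_nonneg (P.pos_nonneg x) (P.pos_le_one x))]
  exact F.weight_le_one (P.pos_nonneg x) (P.pos_le_one x)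

lemma integrable_pos {ν : Measure X} [IsFiniteMeasure ν] : Integrable P.pos ν :=
  integrable_of_abs_le_one P.measurable_pos fun x => by
    rw [abs_of_nonneg (P.pos_nonneg x)]; exact P.pos_le_one x

lemma integrable_decision {ν : Measure X} [IsFiniteMeasure ν] (d : Decision X) :
    Integrable d.pos ν :=
  integrable_of_abs_le_one d.measurable_pos fun x => by
    rw [abs_of_nonneg (d.pos_nonneg x)]; exact d.pos_le_one x

lemma integrable_mul_of_integrable {ν : Measure X} (d : Decision X) {h : X → ℝ}
    (hh : Integrable h ν) : Integrable (fun x => d.pos x * h x) ν :=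
  hh.bdd_mul d.measurable_pos.aestronglyMeasurable (c := 1) (.of_forall fun x => by
    rw [Real.norm_eq_abs, abs_of_nonneg (d.pos_nonneg x)]; exact d.pos_le_one x)

/-- The fairness measures are continuous functions of the weighted masses of positive predictions
in the two groups. -/
lemma exists_continuous_value_eq (F : FairnessMeasure) (A₀ A₁ : Set X) :
    ∃ φ : ℝ → ℝ → ℝ, Continuous (fun z : ℝ × ℝ => φ z.1 z.2) ∧ ∀ d : Decision X,
      F.value P A₀ A₁ d = φ (∫ x in A₀, d.pos x * F.weight (P.pos x) ∂P.μ)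
        (∫ x in A₁, d.pos x * F.weight (P.pos x) ∂P.μ) := by
  -- Each conditional probability is affine in the weighted mass, with a denominator independent of
  -- `d`. If the denominator is `0`, the quotient is constantly `0` and still continuous.
  have key : ∃ ψ : Set X → ℝ → ℝ, (∀ A, Continuous (ψ A)) ∧ ∀ d : Decision X,
      F.value P A₀ A₁ d = |ψ A₁ (∫ x in A₁, d.pos x * F.weight (P.pos x) ∂P.μ) -
        ψ A₀ (∫ x in A₀, d.pos x * F.weight (P.pos x) ∂P.μ)| := by
    have hd : ∀ d : Decision X, ∀ x, (d x).1 1 = d.pos x := fun _ _ => rfl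
    have hp : ∀ x, (P.p x).1 1 = P.pos x := fun _ => rfl
    have hi : ∀ (d : Decision X) (A : Set X) (h : X → ℝ), Integrable h P.μ →
        ∫ x in A, (1 - d.pos x) * h x ∂P.μ =
          ∫ x in A, h x ∂P.μ - ∫ x in A, d.pos x * h x ∂P.μ := by
      intro d A h hh
      simp only [sub_mul, one_mul]
      exact integral_sub hh.integrableOn (integrable_mul_of_integrable d hh.integrableOn)
    have hp1 : Integrable P.pos P.μ := P.integrable_pos
    have hp0 : Integrable (fun x => 1 - P.pos x) P.μ := (integrable_const 1).sub hp1
    cases F with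
    | demographicParity =>
      refine ⟨fun A t => t / ∫ x in A, 1 ∂P.μ, fun A => by fun_prop, fun d => ?_⟩
      have hs : ∀ A : Set X, ∫ x in A, d.pos x * (1 - P.pos x) ∂P.μ
          + ∫ x in A, d.pos x * P.pos x ∂P.μ = ∫ x in A, d.pos x ∂P.μ := by
        intro A
        rw [← integral_add (integrable_mul_of_integrable d hp0.integrableOn)
          (integrable_mul_of_integrable d hp1.integrableOn)]
        congr 1 with x
        ring
      have ht : ∀ A : Set X, ∫ x in A, (1 - P.pos x) ∂P.μ
          + ∫ x in A, P.pos x ∂P.μ = ∫ x in A, 1 ∂P.μ := by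
        intro A
        rw [← integral_add hp0.integrableOn hp1.integrableOn]
        congr 1 with x
        ring
      have hc : ∀ A : Set X, P.condProb d {z | z.2.2 = 1} {z | z.1 ∈ A} =
          (∫ x in A, d.pos x ∂P.μ) / ∫ x in A, 1 ∂P.μ := by
        intro A
        rw [← hs, ← ht]
        simp only [condProb, prob, Fin.sum_univ_two, mem_inter_iff, mem_ofPred_eq,
          Fin.zero_eq_one_iff, OfNat.ofNat_ne_one, false_and, true_and, ofPred_false,
          Measure.restrict_empty, integral_zero_measure, zero_add, ofPred_mem_eq, hd, hp,
          Decision.coord_zero, coord_zero, hi _ _ _ hp1, hi _ _ _ hp0]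
        congr 1
        ring
      simp [FairnessMeasure.value, FairnessMeasure.weight, hc]
    | equalOpportunity =>
      refine ⟨fun A t => t / ∫ x in A, P.pos x ∂P.μ, fun A => by fun_prop, fun d => ?_⟩
      have hc : ∀ A : Set X, P.condProb d {z | z.2.2 = 1} {z | z.2.1 = 1 ∧ z.1 ∈ A} =
          (∫ x in A, d.pos x * P.pos x ∂P.μ) / ∫ x in A, P.pos x ∂P.μ := by
        intro A
        simp only [condProb, prob, Fin.sum_univ_two, mem_inter_iff, mem_ofPred_eq,
          Fin.zero_eq_one_iff, OfNat.ofNat_ne_one, false_and, true_and, ofPred_false,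
          Measure.restrict_empty, integral_zero_measure, zero_add, add_zero, ofPred_mem_eq, hd, hp,
          Decision.coord_zero, coord_zero, hi _ _ _ hp1]
        congr 1
        ring
      simp [FairnessMeasure.value, FairnessMeasure.weight, hc]
    | equalRisk =>
      refine ⟨fun A t => (∫ x in A, (1 - P.pos x) ∂P.μ - t) / ∫ x in A, (1 - P.pos x) ∂P.μ,
        fun A => by fun_prop, fun d => ?_⟩
      have hc : ∀ A : Set X, P.condProb d {z | z.2.2 = 0} {z | z.2.1 = 0 ∧ z.1 ∈ A} =
          (∫ x in A, (1 - P.pos x) ∂P.μ - ∫ x in A, d.pos x * (1 - P.pos x) ∂P.μ) /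
            ∫ x in A, (1 - P.pos x) ∂P.μ := by
        intro A
        simp only [condProb, prob, Fin.sum_univ_two, mem_inter_iff, mem_ofPred_eq,
          one_ne_zero, false_and, true_and, ofPred_false,
          Measure.restrict_empty, integral_zero_measure, add_zero, ofPred_mem_eq, hd, hp,
          Decision.coord_zero, coord_zero, hi _ _ _ hp0]
        congr 1
        ring
      simp [FairnessMeasure.value, FairnessMeasure.weight, hc]
  obtain ⟨ψ, hψ, h⟩ := key
  refine ⟨fun a b => |ψ A₁ b - ψ A₀ a|, ?_, h⟩
  exact (((hψ A₁).comp continuous_snd).sub ((hψ A₀).comp continuous_fst)).abs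

/-! ### Pareto comparison at equal weighted mass -/

/-- Among the decisions with a given weighted mass of positive predictions, a threshold decision
has the most true positives and true negatives. -/
lemma pareto_of_threshold {ν : Measure X} [IsFiniteMeasure ν] (F : FairnessMeasure)
    (d t : Decision X) {c : ℝ} (hc0 : 0 ≤ c) (hc1 : c ≤ 1)
    (ht : ∀ᵐ x ∂ν, t.pos x = if c ≤ P.pos x then 1 else 0)
    (hp0 : ∀ᵐ x ∂ν, P.pos x ≠ 0) (hp1 : ∀ᵐ x ∂ν, P.pos x ≠ 1)
    (heq : ∫ x, t.pos x * F.weight (P.pos x) ∂ν = ∫ x, d.pos x * F.weight (P.pos x) ∂ν) :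
    ∫ x, d.pos x * P.pos x ∂ν ≤ ∫ x, t.pos x * P.pos x ∂ν ∧
      ∫ x, (1 - d.pos x) * (1 - P.pos x) ∂ν ≤ ∫ x, (1 - t.pos x) * (1 - P.pos x) ∂ν := by
  have hdi : Integrable d.pos ν := integrable_decision d
  have hti : Integrable t.pos ν := integrable_decision t
  have hpi : Integrable P.pos ν := P.integrable_pos
  have hdp := integrable_mul_of_integrable d hpi
  have htp := integrable_mul_of_integrable t hpi
  have hE : ∀ e : Decision X, ∫ x, (1 - e.pos x) * (1 - P.pos x) ∂ν =
      ∫ x, (1 - P.pos x) ∂ν - ∫ x, e.pos x ∂ν + ∫ x, e.pos x * P.pos x ∂ν := by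
    intro e
    have he : Integrable e.pos ν := integrable_decision e
    have h1 : Integrable (fun x => 1 - P.pos x) ν := (integrable_const 1).sub hpi
    have h2 : Integrable (fun x => 1 - P.pos x - e.pos x) ν := h1.sub he
    rw [← integral_sub h1 he, ← integral_add h2 (integrable_mul_of_integrable e hpi)]
    congr 1 with x
    ring
  have hW : ∀ e : Decision X, ∫ x, e.pos x * (1 - P.pos x) ∂ν =
      ∫ x, e.pos x ∂ν - ∫ x, e.pos x * P.pos x ∂ν := by
    intro e
    rw [← integral_sub (integrable_decision e) (integrable_mul_of_integrable e hpi)]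
    congr 1 with x
    ring
  -- Integrate `(t - d)(p₁ - c) ≥ 0`. With `T = ∫ (t - d)` and `U = ∫ (t - d) p₁` this reads `U ≥ c
  -- T`; the gain in true positives is `U`, and by `hE` that in true negatives is `U - T`. Equal
  -- weighted mass means `T = 0`, `U = 0` or `U = T` in the three cases.
  have hkey : 0 ≤ (∫ x, t.pos x * P.pos x ∂ν - ∫ x, d.pos x * P.pos x ∂ν)
      - c * (∫ x, t.pos x ∂ν - ∫ x, d.pos x ∂ν) := by
    have h1 : Integrable (fun x => t.pos x * P.pos x - d.pos x * P.pos x) ν := htp.sub hdp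
    have h2 : Integrable (fun x => c * (t.pos x - d.pos x)) ν := (hti.sub hdi).const_mul c
    rw [← integral_sub htp hdp, ← integral_sub hti hdi, ← integral_const_mul, ← integral_sub h1 h2]
    refine integral_nonneg_of_ae ?_
    filter_upwards [ht] with x hx
    have h0 := d.pos_nonneg x
    have h1 := d.pos_le_one x
    simp only [hx, Pi.zero_apply]
    split_ifs with h
    · nlinarith
    · nlinarith [not_le.1 h]
  rw [hE, hE]
  cases F with
  | demographicParity =>
    simp only [FairnessMeasure.weight, mul_one] at heq
    rw [heq] at hkey ⊢
    constructor <;> linarith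
  | equalOpportunity =>
    simp only [FairnessMeasure.weight] at heq
    -- For `c = 0`, `U ≥ c T` says nothing about `T`; but then `t = 1`, and equal mass with `p₁ ≠ 0`
    -- forces `d = 1` a.e.
    rcases hc0.eq_or_lt with rfl | hc
    · have hz : ∫ x, (t.pos x - d.pos x) * P.pos x ∂ν = 0 := by
        simp only [sub_mul]
        rw [integral_sub htp hdp, heq, sub_self]
      have ht1 : ∀ᵐ x ∂ν, t.pos x = 1 := by
        filter_upwards [ht] with x hx
        rw [hx, if_pos (P.pos_nonneg x)]
      rw [integral_eq_zero_iff_of_nonneg_ae] at hz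
      · have hE' : ∫ x, t.pos x ∂ν = ∫ x, d.pos x ∂ν := by
          refine integral_congr_ae ?_
          filter_upwards [hz, hp0] with x hx hx0
          have := (mul_eq_zero.1 hx).resolve_right hx0
          linarith
        constructor <;> linarith
      · filter_upwards [ht1] with x hx
        rw [hx]
        exact mul_nonneg (sub_nonneg.2 (d.pos_le_one x)) (P.pos_nonneg x)
      · simp only [sub_mul]
        exact htp.sub hdp
    · have : ∫ x, t.pos x ∂ν - ∫ x, d.pos x ∂ν ≤ 0 := by
        by_contra! h
        nlinarith [mul_pos hc h]
      constructor <;> linarith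
  | equalRisk =>
    simp only [FairnessMeasure.weight] at heq
    rw [hW, hW] at heq
    -- Here `(1 - c) T ≥ 0`, which is void for `c = 1`; in that case `t = 0` a.e., and equal mass
    -- with `p₁ ≠ 1` forces `d = 0` a.e.
    rcases hc1.eq_or_lt with rfl | hc
    · have ht0 : ∀ᵐ x ∂ν, t.pos x = 0 := by
        filter_upwards [ht, hp1] with x hx hx1
        rw [hx, if_neg ((P.pos_le_one x).lt_of_ne hx1).not_ge]
      have hz : ∫ x, (d.pos x) * (1 - P.pos x) ∂ν = 0 := by
        rw [hW, ← heq, ← hW]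
        refine integral_eq_zero_of_ae ?_
        filter_upwards [ht0] with x hx
        simp [hx]
      rw [integral_eq_zero_iff_of_nonneg_ae] at hz
      · have hE' : ∫ x, t.pos x ∂ν = ∫ x, d.pos x ∂ν := by
          refine integral_congr_ae ?_
          filter_upwards [hz, hp1, ht0] with x hx hx1 hx0
          rw [hx0, (mul_eq_zero.1 hx).resolve_right (sub_ne_zero.2 hx1.symm)]
        constructor <;> linarith
      · exact .of_forall fun x => mul_nonneg (d.pos_nonneg x) (sub_nonneg.2 (P.pos_le_one x))
      · exact integrable_mul_of_integrable d ((integrable_const 1).sub hpi)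
    · have : 0 ≤ ∫ x, t.pos x ∂ν - ∫ x, d.pos x ∂ν := by
        by_contra! h
        nlinarith [mul_pos (sub_pos.2 hc) (neg_pos.2 h)]
      constructor <;> linarith

/-! ### Matching a decision by thresholds, cell by cell -/

section Threshold

variable {ι : Type*} [Fintype ι] [MeasurableSpace ι] [MeasurableSingletonClass ι]
  {g : X → ι} (hg : Measurable g)

/-- Every decision can be matched by a threshold decision in each group. -/
lemma exists_threshold_eq (F : FairnessMeasure) (d : Decision X) :
    ∃ c : ι → ℝ, (∀ i, c i ∈ Icc (0 : ℝ) 1) ∧ ∀ i,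
      ∫ x in g ⁻¹' {i}, (P.threshold hg c).pos x * F.weight (P.pos x) ∂P.μ =
        ∫ x in g ⁻¹' {i}, d.pos x * F.weight (P.pos x) ∂P.μ := by
  have hw := P.integrable_weight F
  have key : ∀ i, ∃ a ∈ Icc (0 : ℝ) 1,
      ∫ x in g ⁻¹' {i}, (P.threshold hg fun _ => a).pos x * F.weight (P.pos x) ∂P.μ =
        ∫ x in g ⁻¹' {i}, d.pos x * F.weight (P.pos x) ∂P.μ := by
    intro i
    have hcont : Continuous fun a : ℝ =>
        ∫ x in g ⁻¹' {i}, (P.threshold hg fun _ => a).pos x * F.weight (P.pos x) ∂P.μ :=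
      (P.continuous_integral_threshold hg (s := g ⁻¹' {i}) hw).comp
        (continuous_pi fun _ => continuous_id)
    have hw0 : ∀ x, 0 ≤ F.weight (P.pos x) :=
      fun x => F.weight_nonneg (P.pos_nonneg x) (P.pos_le_one x)
    -- Threshold `1` gives mass `0`, since `p₁ < 1` a.e.; threshold `0` predicts `1` everywhere and
    -- gives the largest mass.
    refine intermediate_value_Icc' zero_le_one hcont.continuousOn ⟨?_, ?_⟩
    · rw [integral_eq_zero_of_ae]
      · exact integral_nonneg fun x => mul_nonneg (d.pos_nonneg x) (hw0 x)
      · refine ae_restrict_of_ae ?_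
        filter_upwards [P.ae_pos_ne 1] with x hx
        simp [pos_threshold, ((P.pos_le_one x).lt_of_ne hx).not_ge]
    · refine integral_mono (integrable_mul_of_integrable d hw.integrableOn)
        (integrable_mul_of_integrable _ hw.integrableOn) fun x => ?_
      refine mul_le_mul_of_nonneg_right ?_ (hw0 x)
      rw [pos_threshold, if_pos (P.pos_nonneg x)]
      exact d.pos_le_one x
  choose c hc hce using key
  refine ⟨c, hc, fun i => ?_⟩
  rw [← hce i]
  -- On the cell `i` only `c i` matters, so thresholds found separately can be combined.
  refine setIntegral_congr_fun (hg (measurableSet_singleton i)) fun x hx => ?_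
  simp only [pos_threshold, show g x = i from hx]

include hg in
lemma integral_eq_sum_fiber {f : X → ℝ} (hf : Integrable f P.μ) :
    ∫ x, f x ∂P.μ = ∑ i, ∫ x in g ⁻¹' {i}, f x ∂P.μ := by
  rw [← integral_iUnion_fintype (fun i => hg (measurableSet_singleton i))
    (pairwise_disjoint_fiber g) fun i => hf.integrableOn]
  rw [← preimage_iUnion, iUnion_of_singleton, preimage_univ, setIntegral_univ]

/-- Every decision is dominated by a threshold decision with the same fairness weights. -/
lemma exists_threshold_dominating (F : FairnessMeasure) (d : Decision X) :
    ∃ c : ι → ℝ, (∀ i, c i ∈ Icc (0 : ℝ) 1) ∧ P.ParetoLE d (P.threshold hg c) ∧ ∀ i,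
      ∫ x in g ⁻¹' {i}, (P.threshold hg c).pos x * F.weight (P.pos x) ∂P.μ =
        ∫ x in g ⁻¹' {i}, d.pos x * F.weight (P.pos x) ∂P.μ := by
  obtain ⟨c, hc, he⟩ := P.exists_threshold_eq hg F d
  refine ⟨c, hc, ?_, he⟩
  have hpar := fun i => P.pareto_of_threshold (ν := P.μ.restrict (g ⁻¹' {i})) F d
    (P.threshold hg c) (hc i).1 (hc i).2
    (by
      filter_upwards [ae_restrict_mem (hg (measurableSet_singleton i))] with x hx
      rw [pos_threshold, show g x = i from hx])
    (ae_restrict_of_ae (P.ae_pos_ne 0)) (ae_restrict_of_ae (P.ae_pos_ne 1)) (he i)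
  have h1 : ∀ e : Decision X, Integrable (fun x => e.pos x * P.pos x) P.μ :=
    fun e => integrable_mul_of_integrable e P.integrable_pos
  have h0 : ∀ e : Decision X, Integrable (fun x => (1 - e.pos x) * (1 - P.pos x)) P.μ := by
    intro e
    have hp : Integrable (fun x => 1 - P.pos x) P.μ := (integrable_const 1).sub P.integrable_pos
    simp only [sub_mul, one_mul]
    exact hp.sub (integrable_mul_of_integrable e hp)
  rw [ParetoLE, Fin.forall_fin_two]
  constructor
  · change P.trueNeg d ≤ P.trueNeg _
    rw [trueNeg_eq, trueNeg_eq, P.integral_eq_sum_fiber hg (h0 _),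
      P.integral_eq_sum_fiber hg (h0 _)]
    exact Finset.sum_le_sum fun i _ => (hpar i).2
  · change P.truePos d ≤ P.truePos _
    rw [truePos_eq, truePos_eq, P.integral_eq_sum_fiber hg (h1 _),
      P.integral_eq_sum_fiber hg (h1 _)]
    exact Finset.sum_le_sum fun i _ => (hpar i).1

/-! ### Existence of an optimal threshold decision -/

lemma continuous_truePos_threshold :
    Continuous fun c : ι → ℝ => P.truePos (P.threshold hg c) := by
  simp only [truePos_eq]
  simpa using P.continuous_integral_threshold hg (s := univ) P.integrable_pos

lemma continuous_trueNeg_threshold :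
    Continuous fun c : ι → ℝ => P.trueNeg (P.threshold hg c) := by
  have hp : Integrable (fun x => 1 - P.pos x) P.μ := (integrable_const 1).sub P.integrable_pos
  simp only [trueNeg_eq, sub_mul, one_mul]
  simp only [integral_sub hp (integrable_mul_of_integrable _ hp)]
  refine continuous_const.sub ?_
  simpa using P.continuous_integral_threshold hg (s := univ) hp

/-- A continuous evaluation is continuous along a family of decisions on a fixed problem whose
probabilities of true negatives and true positives vary continuously. -/
lemma _root_.Evaluation.IsContinuous.comp_decision {L : Evaluation.{u}} (hL : L.IsContinuous)
    {T : Type*} [TopologicalSpace T] {d : T → Decision X}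
    (hn : Continuous fun c => P.trueNeg (d c)) (hp : Continuous fun c => P.truePos (d c)) :
    Continuous fun c => L X P (d c) := by
  refine continuous_iff_continuousAt.2 fun c => Metric.tendsto_nhds.2 fun ε hε => ?_
  obtain ⟨δ, hδ, h⟩ := hL X P (d c) ε hε
  filter_upwards [Metric.tendsto_nhds.1 (hn.tendsto c) δ hδ,
    Metric.tendsto_nhds.1 (hp.tendsto c) δ hδ] with c' h1 h2
  -- The problem is fixed, so the symmetric difference of the individual pieces sets is empty.
  exact h X P (d c') h1 h2 (by simpa using hδ)

/-- The fair optimum for two of the groups is attained by a threshold decision. -/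
lemma exists_threshold_isFairOptimum {L : Evaluation.{u}} (hL : IsEvaluationMetric L)
    (F : FairnessMeasure) (i₀ i₁ : ι)
    (h : L.IsContinuous ∨ ∃ d, IsFairOptimum P L F (g ⁻¹' {i₀}) (g ⁻¹' {i₁}) d) :
    ∃ c : ι → ℝ, IsFairOptimum P L F (g ⁻¹' {i₀}) (g ⁻¹' {i₁}) (P.threshold hg c) := by
  obtain ⟨φ, hφ, hval⟩ := P.exists_continuous_value_eq F (g ⁻¹' {i₀}) (g ⁻¹' {i₁})
  -- Thresholds in the cube suffice, so a maximum over this compact set is a maximum over all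
  -- decisions.
  have hdom : ∀ d : Decision X, ∃ c : ι → ℝ, c ∈ Icc (0 : ι → ℝ) 1 ∧
      L X P d - F.value P (g ⁻¹' {i₀}) (g ⁻¹' {i₁}) d ≤
        L X P (P.threshold hg c) -
          F.value P (g ⁻¹' {i₀}) (g ⁻¹' {i₁}) (P.threshold hg c) := by
    intro d
    obtain ⟨c, hc, hle, he⟩ := P.exists_threshold_dominating hg F d
    refine ⟨c, ⟨fun i => (hc i).1, fun i => (hc i).2⟩, ?_⟩
    rw [hval, hval, he, he]
    exact sub_le_sub_right (hL.mono X P _ _ hle) _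
  rcases h with hcont | ⟨d, hd⟩
  · have hw := P.integrable_weight F
    have hobj : Continuous fun c : ι → ℝ => L X P (P.threshold hg c) -
        F.value P (g ⁻¹' {i₀}) (g ⁻¹' {i₁}) (P.threshold hg c) := by
      simp only [hval]
      exact (hcont.comp_decision P (P.continuous_trueNeg_threshold hg)
        (P.continuous_truePos_threshold hg)).sub
        (hφ.comp ((P.continuous_integral_threshold hg hw).prodMk
          (P.continuous_integral_threshold hg hw)))
    obtain ⟨c, -, hmax⟩ := isCompact_Icc.exists_isMaxOn
      (nonempty_Icc.2 (zero_le_one (α := ι → ℝ))) hobj.continuousOn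
    refine ⟨c, fun d' => ?_⟩
    obtain ⟨c', hc', hle⟩ := hdom d'
    exact hle.trans (hmax hc')
  · obtain ⟨c, -, hle⟩ := hdom d
    exact ⟨c, fun d' => (hd d').trans hle⟩

end Threshold

end ClassificationProblem

end

open Classical in
theorem exists_fairOptimum_noCherryPick {X : Type u} [MeasurableSpace X]
    (P : ClassificationProblem X) (A₀ A₁ : Set X) (hA₀ : MeasurableSet A₀)
    (hA₁ : MeasurableSet A₁) (hdisj : Disjoint A₀ A₁) (hunion : A₀ ∪ A₁ = Set.univ)
    (L : Evaluation.{u}) (hL : IsEvaluationMetric L) (F : FairnessMeasure)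
    (S : Set X) (hS : MeasurableSet S)
    (h : L.IsContinuous ∨ ∃ d, IsFairOptimum P L F (A₀ ∩ S) (A₁ ∩ S) d) :
    ∃ d, P.IsDeterministic d ∧ IsFairOptimum P L F (A₀ ∩ S) (A₁ ∩ S) d ∧
      P.NoCherryPick {A₀ ∩ S, A₁ ∩ S, A₀ \ S, A₁ \ S} d := by
  obtain rfl : A₀ = A₁ᶜ := (isCompl_iff.2 ⟨hdisj, codisjoint_iff.2 hunion⟩).eq_compl
  -- The fibres of `g` are the four groups; only the two inside `S` enter `F`, but each gets its own
  -- threshold.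
  let g : X → Bool × Bool := fun x => (decide (x ∈ A₁), decide (x ∈ S))
  have hg : Measurable g :=
    (measurable_to_bool (by simpa [preimage] using hA₁)).prodMk
      (measurable_to_bool (by simpa [preimage] using hS))
  have h0 : A₁ᶜ ∩ S = g ⁻¹' {(false, true)} := by ext x; simp [g]
  have h1 : A₁ ∩ S = g ⁻¹' {(true, true)} := by ext x; simp [g]
  have h2 : A₁ᶜ \ S = g ⁻¹' {(false, false)} := by ext x; simp [g]
  have h3 : A₁ \ S = g ⁻¹' {(true, false)} := by ext x; simp [g]
  rw [h0, h1] at h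
  rw [h0, h1, h2, h3]
  obtain ⟨c, hc⟩ := P.exists_threshold_isFairOptimum hg hL F _ _ h
  refine ⟨_, P.isDeterministic_threshold hg c, hc, P.noCherryPick_threshold hg c ?_⟩
  rintro A (rfl | rfl | rfl | rfl) <;>
    exact ⟨hg (measurableSet_singleton _), _, fun x hx => hx⟩

theorem mainTheorem1 {X : Type u} [MeasurableSpace X] (P : ClassificationProblem X)
    (A₀ A₁ : Set X) (hA₀ : MeasurableSet A₀) (hA₁ : MeasurableSet A₁)
    (hdisj : Disjoint A₀ A₁) (hunion : A₀ ∪ A₁ = Set.univ)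
    (hpos₀ : P.μ A₀ ≠ 0) (hpos₁ : P.μ A₁ ≠ 0)
    (L : Evaluation.{u}) (hL : IsEvaluationMetric L) (F : FairnessMeasure) :
    -- the fairness measure for the two sensitive groups
    ((L.IsContinuous ∨ ∃ d, IsFairOptimum P L F A₀ A₁ d) →
      ∃ d, P.IsDeterministic d ∧ IsFairOptimum P L F A₀ A₁ d ∧ P.NoCherryPick {A₀, A₁} d) ∧
    -- its conditional version, for the subgroups that satisfy a requirement `S`
    (∀ S : Set X, MeasurableSet S → P.μ (A₀ ∩ S) ≠ 0 → P.μ (A₁ ∩ S) ≠ 0 →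
      (L.IsContinuous ∨ ∃ d, IsFairOptimum P L F (A₀ ∩ S) (A₁ ∩ S) d) →
      ∃ d, P.IsDeterministic d ∧ IsFairOptimum P L F (A₀ ∩ S) (A₁ ∩ S) d ∧
        P.NoCherryPick {A₀ ∩ S, A₁ ∩ S, A₀ \ S, A₁ \ S} d) := by
  refine ⟨fun h => ?_, fun S hS _ _ h =>
    exists_fairOptimum_noCherryPick P A₀ A₁ hA₀ hA₁ hdisj hunion L hL F S hS h⟩
  -- The unconditional case is the requirement that everyone satisfies.
  have key := exists_fairOptimum_noCherryPick P A₀ A₁ hA₀ hA₁ hdisj hunion L hL F univ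
    MeasurableSet.univ
  simp only [inter_univ] at key
  obtain ⟨d, hd, hopt, hcp⟩ := key h
  refine ⟨d, hd, hopt, fun A hA => hcp A ?_⟩
  rcases hA with rfl | rfl <;> simp
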